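/- For real $s,\beta$ let $T=T_{s,\beta}:\mathbb R\to\mathbb R$ be the map $T(x)=x+2$ for $x\le 0$ and $T(x)=-s\,x+\beta$ for $x>0$. We say that the Lyapunov exponent of $T$ equals $\lambda$ if $T$ has an invariant Borel probability measure that is absolutely continuous with respect to Lebesgue measure and, for every such measure $\mu$, the function $\ln|T'|$ is $\mu$-integrable with $\int \ln|T'(x)|\,d\mu(x)=\lambda$ and, for $\mu$-almost every $x_0$, the orbit $x_k=T^k(x_0)$ satisfies $\lim_{n\to\infty}\frac1n\sum_{k=0}^{n-1}\ln|T'(x_k)|=\lambda$. (i) If $s=2$ and $2<\beta<\frac92$, then the Lyapunov exponent of $T$ equals $\frac23\ln 2$; in particular it does not depend on $\beta$ in this range. (ii) If $s=\phi=\frac{1+\sqrt5}{2}$ and $2\phi<\beta<4$, then the Lyapunov exponent of $T$ equals $\frac{3-\phi}{5-2\phi}\ln\phi$; in particular it does not depend on $\beta$ in this range. -/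

import Mathlib

open Filter Topology MeasureTheory

/-- The two-branch piecewise linear map: `T x = x + 2` for `x ≤ 0`, `T x = -s x + β` for `x > 0`. -/
noncomputable def plMap (s β : ℝ) (x : ℝ) : ℝ :=
  if x ≤ 0 then x + 2 else -s * x + β

/-- `μ` is an invariant probability measure of `f` that has a density with respect to Lebesgue
measure. -/
structure IsACInvariantProbability (f : ℝ → ℝ) (μ : Measure ℝ) : Prop where
  isProbabilityMeasure : IsProbabilityMeasure μ
  measurePreserving : MeasurePreserving f μ μ
  absolutelyContinuous : μ ≪ (volume : Measure ℝ)

/-- The Lyapunov exponent of `f` along the orbit of `x₀` exists and equals `l`: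
`(1/n) ∑_{k<n} ln |f'(x_k)| → l` with `x_k = f^k (x₀)`. The orbit is required to stay in the set
where `f` is differentiable with nonzero derivative (the value of `deriv` is `0` where `f` is not
differentiable), so that every logarithm is meaningful. -/
def HasPointwiseLyapunovExponent (f : ℝ → ℝ) (x₀ l : ℝ) : Prop :=
  (∀ k : ℕ, deriv f (f^[k] x₀) ≠ 0) ∧
    Tendsto (fun n : ℕ => (1 / (n : ℝ)) * ∑ k ∈ Finset.range n, Real.log |deriv f (f^[k] x₀)|)
      atTop (𝓝 l)

/-- The Lyapunov exponent `∫ ln |f'| dμ` of `f` with respect to `μ` is well defined and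
equals `l`. -/
def HasLyapunovExponent (f : ℝ → ℝ) (μ : Measure ℝ) (l : ℝ) : Prop :=
  (∀ᵐ x ∂μ, deriv f x ≠ 0) ∧ Integrable (fun x => Real.log |deriv f x|) μ ∧
    ∫ x, Real.log |deriv f x| ∂μ = l

/-- The Lyapunov exponent of `f` is `l`: there is an absolutely continuous invariant probability
measure, and for every such measure `μ` the exponent with respect to `μ` is `l`, as is the exponent
along the orbit of `μ`-almost every point. -/
def LyapunovExponentEq (f : ℝ → ℝ) (l : ℝ) : Prop :=
  (∃ μ : Measure ℝ, IsACInvariantProbability f μ) ∧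
    ∀ μ : Measure ℝ, IsACInvariantProbability f μ →
      HasLyapunovExponent f μ l ∧ ∀ᵐ x ∂μ, HasPointwiseLyapunovExponent f x l

/-! Every orbit enters the trapping interval `(β - sβ, β)`. There the exponent is `ln s` times the
mass of `(0, ∞)` under the invariant density, so two things are needed: an explicit density and
ergodicity.

Density: the transfer operator sends a step at `p` to a step at `T p`, plus steps at the one-sided
values `T(0⁻) = 2` and `T(0⁺) = β`. In both parameter ranges the orbits of `2` and `β` meet after
equally many steps, with equal derivatives counted from `0⁻` and `0⁺`. The jumps then cancel, and a
finite combination of steps along the two orbits is fixed (`lyapunovExponentEq_of_steps`). Its total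
mass and its mass on `(0, ∞)` do not involve `β`.

Ergodicity (`ergodic_plMap`): the iterates are affine and expanding away from `0`. Blowing up around
a density point makes an invariant set of positive measure full on an interval (`exists_aeFull`),
and images of intervals grow until they cover a fixed one (`AEFull.exists_large`). Since the density
is positive on the trapping interval, every absolutely continuous invariant probability equals this
one, and the pointwise ergodic theorem gives the orbit averages. -/

/-! ### Maximal inequality and pointwise ergodic theorem -/

section Birkhoff

variable {α : Type*}

/-- The maximum of `0` and the first `n` Birkhoff sums of `g` along `f`. -/
noncomputable def birkhoffMax (f : α → α) (g : α → ℝ) : ℕ → α → ℝ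
  | 0 => fun _ => 0
  | n + 1 => fun x => max 0 (g x + birkhoffMax f g n (f x))

theorem birkhoffMax_nonneg (f : α → α) (g : α → ℝ) (n : ℕ) (x : α) : 0 ≤ birkhoffMax f g n x := by
  cases n with
  | zero => exact le_rfl
  | succ n => exact le_max_left _ _

theorem birkhoffMax_le_succ (f : α → α) (g : α → ℝ) (n : ℕ) (x : α) :
    birkhoffMax f g n x ≤ birkhoffMax f g (n + 1) x := by
  induction n generalizing x with
  | zero => exact birkhoffMax_nonneg f g 1 x
  | succ n ih => exact max_le_max le_rfl (by linarith [ih (f x)])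

theorem birkhoffSum_le_birkhoffMax (f : α → α) (g : α → ℝ) (n : ℕ) (x : α) :
    birkhoffSum f g n x ≤ birkhoffMax f g n x := by
  induction n generalizing x with
  | zero => simp [birkhoffMax]
  | succ n ih =>
    rw [birkhoffSum_succ']
    exact le_max_of_le_right (by linarith [ih (f x)])

variable [MeasurableSpace α] {μ : Measure α} {f : α → α} {g : α → ℝ}

theorem integrable_birkhoffMax (hf : MeasurePreserving f μ μ) (hg : Integrable g μ) (n : ℕ) :
    Integrable (birkhoffMax f g n) μ := by
  induction n with
  | zero => exact integrable_zero _ _ _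
  | succ n ih =>
    exact (integrable_zero _ _ _).sup (hg.add (hf.integrable_comp_of_integrable ih))

/-- Maximal ergodic inequality. -/
theorem setIntegral_birkhoffMax_pos_nonneg (hf : MeasurePreserving f μ μ) (hgm : Measurable g)
    (hg : Integrable g μ) (n : ℕ) :
    0 ≤ ∫ x, {x | 0 < birkhoffMax f g (n + 1) x}.indicator g x ∂μ := by
  have hm : ∀ n, Measurable (birkhoffMax f g n) := by
    intro n
    induction n with
    | zero => exact measurable_const
    | succ n ih => exact measurable_const.max (hgm.add (ih.comp hf.measurable))
  have hint := integrable_birkhoffMax hf hg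
  have hcomp : ∫ x, birkhoffMax f g n (f x) ∂μ = ∫ x, birkhoffMax f g n x ∂μ := by
    conv_rhs => rw [← hf.map_eq]
    rw [integral_map hf.measurable.aemeasurable (hm n).aestronglyMeasurable]
  have h1 : 0 ≤ ∫ x, (birkhoffMax f g (n + 1) x - birkhoffMax f g n (f x)) ∂μ := by
    have := integral_sub (hint (n + 1)) (hf.integrable_comp_of_integrable (hint n))
    simp only [Function.comp_apply] at this
    rw [this, hcomp, sub_nonneg]
    exact integral_mono (hint _) (hint _) fun x => birkhoffMax_le_succ f g n x
  refine h1.trans (integral_mono ((hint _).sub (hf.integrable_comp_of_integrable (hint n)))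
    (hg.indicator (measurableSet_lt measurable_const (hm _))) fun x => ?_)
  -- Where the maximum is positive the recursion makes the difference equal to `g`; elsewhere the
  -- difference is at most `0`.
  by_cases hx : 0 < birkhoffMax f g (n + 1) x
  · have : birkhoffMax f g (n + 1) x = g x + birkhoffMax f g n (f x) := by
      have h := hx
      simp only [birkhoffMax, lt_max_iff, lt_irrefl, false_or] at h
      exact max_eq_right h.le
    simp only [Set.indicator, Set.mem_ofPred_eq, hx, if_true]
    linarith
  · simp only [Set.indicator, Set.mem_ofPred_eq, hx, if_false]
    linarith [birkhoffMax_nonneg f g n (f x)]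

/-- If `∫ g < 0`, the Birkhoff sums of `g` are almost everywhere bounded above. -/
theorem Ergodic.ae_bddAbove_birkhoffSum (hf : Ergodic f μ) (hgm : Measurable g)
    (hg : Integrable g μ) (hneg : ∫ x, g x ∂μ < 0) :
    ∀ᵐ x ∂μ, ∃ C : ℕ, ∀ n, birkhoffSum f g n x ≤ C := by
  have hmp := hf.toMeasurePreserving
  have hSm : ∀ n, Measurable (birkhoffSum f g n) := fun n =>
    Finset.measurable_sum _ fun k _ => hgm.comp (hmp.measurable.iterate k)
  set E : Set α := {x | ∃ C : ℕ, ∀ n, birkhoffSum f g n x ≤ C} with hE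
  have hEm : MeasurableSet E := by
    have : E = ⋃ C : ℕ, ⋂ n, {x | birkhoffSum f g n x ≤ C} := by
      ext x; simp [hE]
    rw [this]
    exact .iUnion fun C => .iInter fun n => measurableSet_le (hSm n) measurable_const
  have hinv : f ⁻¹' E = E := by
    ext x
    simp only [hE, Set.mem_preimage, Set.mem_ofPred_eq]
    constructor
    · rintro ⟨C, hC⟩
      obtain ⟨K, hK⟩ := exists_nat_ge (max 0 (g x + C))
      refine ⟨K, fun n => ?_⟩
      cases n with
      | zero => simp
      | succ n =>
        rw [birkhoffSum_succ']
        have := le_max_right 0 (g x + C)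
        linarith [hC n]
    · rintro ⟨C, hC⟩
      obtain ⟨K, hK⟩ := exists_nat_ge (C - g x)
      refine ⟨K, fun n => ?_⟩
      have := hC (n + 1)
      rw [birkhoffSum_succ'] at this
      linarith
  rcases hf.toPreErgodic.ae_mem_or_ae_notMem hEm hinv with h | hae
  · exact h
  · exfalso
    -- If `E` is null, the sets where the maximum is positive increase to almost everything, so the
    -- maximal inequality passes to the limit `∫ g ≥ 0`.
    have hlim : Tendsto (fun n => ∫ x, {x | 0 < birkhoffMax f g (n + 1) x}.indicator g x ∂μ) atTop
        (𝓝 (∫ x, g x ∂μ)) := by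
      refine tendsto_integral_of_dominated_convergence (fun x => |g x|)
        (fun n => ?_) hg.abs (fun n => ?_) ?_
      · refine hg.aestronglyMeasurable.indicator₀ ?_
        exact nullMeasurableSet_lt aemeasurable_const
          (integrable_birkhoffMax hmp hg _).aemeasurable
      · refine .of_forall fun x => ?_
        rw [← Real.norm_eq_abs]
        exact norm_indicator_le_norm_self _ _
      · filter_upwards [hae] with x hx
        simp only [hE, Set.mem_ofPred_eq, not_exists, not_forall, not_le] at hx
        obtain ⟨n, hn⟩ := hx 0
        refine tendsto_const_nhds.congr' ?_
        filter_upwards [eventually_ge_atTop n] with m hm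
        have hpos : 0 < birkhoffMax f g (m + 1) x := by
          refine lt_of_lt_of_le (by simpa using hn)
            ((birkhoffSum_le_birkhoffMax f g n x).trans ?_)
          exact monotone_nat_of_le_succ (fun k => birkhoffMax_le_succ f g k x) (by omega)
        simp [Set.indicator, hpos]
    have := ge_of_tendsto' hlim fun n => setIntegral_birkhoffMax_pos_nonneg hmp hgm hg n
    linarith

theorem Ergodic.ae_eventually_birkhoffSum_le [IsProbabilityMeasure μ] (hf : Ergodic f μ)
    (hgm : Measurable g) (hg : Integrable g μ) :
    ∀ᵐ x ∂μ, ∀ ε > 0, ∀ᶠ n : ℕ in atTop,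
      (1 / (n : ℝ)) * birkhoffSum f g n x ≤ ∫ x, g x ∂μ + ε := by
  set m := ∫ x, g x ∂μ with hm
  have key : ∀ j : ℕ, ∀ᵐ x ∂μ, ∃ C : ℕ, ∀ n,
      birkhoffSum f (fun x => g x - (m + 1 / ((j : ℝ) + 1))) n x ≤ C := by
    -- Subtracting slightly more than the mean makes the integral negative; countably many margins
    -- keep one exceptional null set.
    intro j
    refine hf.ae_bddAbove_birkhoffSum (hgm.sub_const _) (hg.sub (integrable_const _)) ?_
    rw [integral_sub hg (integrable_const _)]
    have : (0 : ℝ) < 1 / ((j : ℝ) + 1) := by positivity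
    simp only [integral_const, probReal_univ, smul_eq_mul]
    linarith
  filter_upwards [ae_all_iff.2 key] with x hx ε hε
  obtain ⟨j, hj⟩ := exists_nat_one_div_lt (half_pos hε)
  obtain ⟨C, hC⟩ := hx j
  obtain ⟨N, hN⟩ := exists_nat_gt (C / (ε / 2))
  filter_upwards [eventually_ge_atTop (N + 1)] with n hn
  have hn0 : (0 : ℝ) < n := by exact_mod_cast (show 0 < n by omega)
  have h1 := hC n
  have h2 : birkhoffSum f (fun x => g x - (m + 1 / ((j : ℝ) + 1))) n x
      = birkhoffSum f g n x - n * (m + 1 / ((j : ℝ) + 1)) := by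
    simp only [birkhoffSum, Finset.sum_sub_distrib, Finset.sum_const, Finset.card_range,
      nsmul_eq_mul]
  rw [h2] at h1
  have h3 : (C : ℝ) < n * (ε / 2) := by
    rw [div_lt_iff₀ (half_pos hε)] at hN
    have : (N : ℝ) ≤ n := by exact_mod_cast (show N ≤ n by omega)
    nlinarith
  rw [one_div, inv_mul_le_iff₀ hn0]
  nlinarith

/-- Pointwise ergodic theorem for an ergodic probability measure. -/
theorem Ergodic.ae_tendsto_birkhoffSum [IsProbabilityMeasure μ] (hf : Ergodic f μ)
    (hgm : Measurable g) (hg : Integrable g μ) :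
    ∀ᵐ x ∂μ, Tendsto (fun n : ℕ => (1 / (n : ℝ)) * birkhoffSum f g n x) atTop
      (𝓝 (∫ x, g x ∂μ)) := by
  filter_upwards [hf.ae_eventually_birkhoffSum_le hgm hg,
    hf.ae_eventually_birkhoffSum_le hgm.neg hg.neg] with x hx hx'
  rw [Metric.tendsto_nhds]
  intro ε hε
  filter_upwards [hx (ε / 2) (half_pos hε), hx' (ε / 2) (half_pos hε)] with n h1 h2
  have h3 : birkhoffSum f (-g) n x = - birkhoffSum f g n x := by
    simp [birkhoffSum, Finset.sum_neg_distrib]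
  simp only [Pi.neg_apply, integral_neg, h3] at h2
  rw [Real.dist_eq, abs_lt]
  constructor <;> linarith

end Birkhoff

/-! ### Affine branches and the trapping interval -/

theorem volume_preimage_mul_add {c : ℝ} (hc : c ≠ 0) (d : ℝ) (S : Set ℝ) :
    volume ((fun y : ℝ => c * y + d) ⁻¹' S) = ENNReal.ofReal |c⁻¹| * volume S := by
  have : (fun y : ℝ => c * y + d) ⁻¹' S = (fun y => c * y) ⁻¹' ((fun y => y + d) ⁻¹' S) := rfl
  rw [this, Real.volume_preimage_mul_left hc, measure_preimage_add_right]

theorem volume_eq_zero_of_preimage_mul_add {c : ℝ} (hc : c ≠ 0) {d : ℝ} {S : Set ℝ}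
    (h : volume ((fun y : ℝ => c * y + d) ⁻¹' S) = 0) : volume S = 0 := by
  rw [volume_preimage_mul_add hc, mul_eq_zero] at h
  refine h.resolve_left ?_
  simpa using hc

theorem plMap_of_nonpos {s β x : ℝ} (hx : x ≤ 0) : plMap s β x = x + 2 := if_pos hx

theorem plMap_of_pos {s β x : ℝ} (hx : 0 < x) : plMap s β x = -s * x + β := if_neg hx.not_ge

theorem measurable_plMap (s β : ℝ) : Measurable (plMap s β) :=
  Measurable.ite measurableSet_Iic (by fun_prop) (by fun_prop)

theorem plMap_mem_Ioo {s β x : ℝ} (hs : 1 < s) (hβ : 2 < β) (hx : x ∈ Set.Ioo (β - s * β) β) :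
    plMap s β x ∈ Set.Ioo (β - s * β) β := by
  obtain ⟨h1, h2⟩ := hx
  rcases le_or_gt x 0 with h | h
  · rw [plMap_of_nonpos h]
    constructor <;> linarith
  · rw [plMap_of_pos h]
    constructor <;> nlinarith

theorem iterate_plMap_mem_Ioo {s β x : ℝ} (hs : 1 < s) (hβ : 2 < β)
    (hx : x ∈ Set.Ioo (β - s * β) β) (n : ℕ) : (plMap s β)^[n] x ∈ Set.Ioo (β - s * β) β := by
  induction n with
  | zero => exact hx
  | succ n ih => rw [Function.iterate_succ_apply']; exact plMap_mem_Ioo hs hβ ih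

/-- Points to the left climb in steps of `2`, and land below `2 < β` when they pass `β - sβ < 0`;
points `≥ β` are first thrown to the left. -/
theorem exists_iterate_plMap_mem_Ioo {s β : ℝ} (hs : 1 < s) (hβ : 2 < β) (x : ℝ) :
    ∃ n, (plMap s β)^[n] x ∈ Set.Ioo (β - s * β) β := by
  have key : ∀ m : ℕ, ∀ x ≤ β - s * β, β - s * β - 2 * m < x →
      ∃ n, (plMap s β)^[n] x ∈ Set.Ioo (β - s * β) β := by
    intro m
    induction m with
    | zero => intro x h1 h2; simp at h2; linarith
    | succ m ih =>
      intro x h1 h2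
      push_cast at h2
      have h0 : x ≤ 0 := by nlinarith
      rcases le_or_gt (x + 2) (β - s * β) with h | h
      · obtain ⟨n, hn⟩ := ih (x + 2) h (by linarith)
        exact ⟨n + 1, by rwa [Function.iterate_succ_apply, plMap_of_nonpos h0]⟩
      · exact ⟨1, by
          rw [Function.iterate_one, plMap_of_nonpos h0]
          exact ⟨h, by linarith⟩⟩
  have low : ∀ x ≤ β - s * β, ∃ n, (plMap s β)^[n] x ∈ Set.Ioo (β - s * β) β := by
    intro x hx
    obtain ⟨m, hm⟩ := exists_nat_gt ((β - s * β - x) / 2)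
    exact key m x hx (by linarith)
  rcases le_or_gt x (β - s * β) with h | h
  · exact low x h
  rcases lt_or_ge x β with h' | h'
  · exact ⟨0, h, h'⟩
  · obtain ⟨n, hn⟩ := low (plMap s β x) (by
      rw [plMap_of_pos (by linarith)]; nlinarith)
    exact ⟨n + 1, by rwa [Function.iterate_succ_apply]⟩

/-! ### Growth of intervals on which an invariant set is full -/

/-- Almost every point of the interval `(a, b)` belongs to `A`. -/
def AEFull (A : Set ℝ) (a b : ℝ) : Prop := volume (Set.Ioo a b \ A) = 0

theorem AEFull.mono {A : Set ℝ} {a b a' b' : ℝ} (h : AEFull A a b) (ha : a ≤ a') (hb : b' ≤ b) :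
    AEFull A a' b' :=
  measure_mono_null (Set.sdiff_subset_sdiff_left (Set.Ioo_subset_Ioo ha hb)) h

theorem AEFull.not_compl {A : Set ℝ} {a b : ℝ} (hab : a < b) (h : AEFull A a b) :
    ¬ AEFull Aᶜ a b := by
  intro h'
  have : volume (Set.Ioo a b) = 0 := by
    rw [← Set.sdiff_union_inter (Set.Ioo a b) A]
    refine measure_union_null h ?_
    simpa [AEFull, Set.sdiff_eq] using h'
  simp [Real.volume_Ioo] at this
  linarith

theorem AEFull.map_of_nonpos {s β : ℝ} {A : Set ℝ} (hA : plMap s β ⁻¹' A = A) {a b : ℝ}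
    (hb : b ≤ 0) (h : AEFull A a b) : AEFull A (a + 2) (b + 2) := by
  refine volume_eq_zero_of_preimage_mul_add (c := 1) (d := 2) one_ne_zero
    (measure_mono_null ?_ h)
  rintro y ⟨⟨h1, h2⟩, h3⟩
  refine ⟨⟨by linarith, by linarith⟩, fun hy => h3 ?_⟩
  rw [← hA, Set.mem_preimage, plMap_of_nonpos (by linarith)] at hy
  simpa using hy

theorem AEFull.map_of_nonneg {s β : ℝ} (hs : 1 < s) {A : Set ℝ} (hA : plMap s β ⁻¹' A = A)
    {a b : ℝ} (ha : 0 ≤ a) (h : AEFull A a b) : AEFull A (β - s * b) (β - s * a) := by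
  refine volume_eq_zero_of_preimage_mul_add (c := -s) (d := β) (by linarith)
    (measure_mono_null ?_ h)
  rintro y ⟨⟨h1, h2⟩, h3⟩
  have h4 : a < y := by simp only at h2; nlinarith
  refine ⟨⟨h4, by simp only at h1; nlinarith⟩, fun hy => h3 ?_⟩
  rwa [← hA, Set.mem_preimage, plMap_of_pos (by linarith)] at hy

/-- A set invariant under `plMap s β` that is full on some interval is full on one of two fixed
intervals, because images of intervals grow. -/
theorem AEFull.exists_large {s β : ℝ} (hs : 1 < s) (hβ : 2 < β)
    (hexp : s + 1 < s ^ 2 ∨ 2 * s ≤ β ∧ 2 < s ^ 2) {A : Set ℝ} (hA : plMap s β ⁻¹' A = A)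
    {a b : ℝ} (hab : a < b) (ha : β - s * β ≤ a) (hb : b ≤ β) (h : AEFull A a b) :
    AEFull A (-2) 0 ∨ AEFull A 0 (β / s) := by
  have hs0 : 0 < s := by linarith
  set S : Set ℝ := {l | ∃ u v, β - s * β ≤ u ∧ u < v ∧ v ≤ β ∧ AEFull A u v ∧ l = v - u} with hS
  have hbdd : BddAbove S := by
    refine ⟨s * β, ?_⟩
    rintro l ⟨u, v, h1, h2, h3, h4, rfl⟩
    linarith
  have hmem : b - a ∈ S := ⟨a, b, ha, hab, hb, h, rfl⟩
  set M := sSup S with hM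
  have hle : ∀ u v, β - s * β ≤ u → u < v → v ≤ β → AEFull A u v → v - u ≤ M :=
    fun u v h1 h2 h3 h4 => le_csSup hbdd ⟨u, v, h1, h2, h3, h4, rfl⟩
  have hM0 : 0 < M := lt_of_lt_of_le (by linarith) (le_csSup hbdd hmem)
  -- Here `u`, `v` are the lengths of the parts left and right of `0`. The bounds give `u + v ≤ M/s
  -- + M/s²`, or `2M/s²` if `2s ≤ β`. The second alternative serves the golden ratio, where `s² = s
  -- + 1`.
  obtain ⟨q, hq1, hq2⟩ : ∃ q : ℝ, 1 < q ∧ ∀ u v : ℝ, 0 ≤ u → 0 ≤ v → s * u ≤ M → s ^ 2 * v ≤ M →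
      (2 * s ≤ β → s ^ 2 * u ≤ M) → q * (u + v) ≤ M := by
    rcases hexp with h1 | ⟨h1, h2⟩
    · refine ⟨s ^ 2 / (s + 1), by rw [one_lt_div (by linarith)]; exact h1,
        fun u v hu hv h3 h4 _ => ?_⟩
      rw [div_mul_eq_mul_div, div_le_iff₀ (by linarith)]
      nlinarith
    · refine ⟨s ^ 2 / 2, by linarith, fun u v hu hv h3 h4 h5 => ?_⟩
      have := h5 h1
      nlinarith
  -- A nearly longest interval: exceeding `M / s` prevents it from lying in `[0, ∞)`, exceeding `M /
  -- q` contradicts the splitting at `0`.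
  obtain ⟨l, ⟨u, v, hu, huv, hv, hfull, rfl⟩, hl⟩ : ∃ l ∈ S, max (M / q) (M / s) < l :=
    exists_lt_of_lt_csSup ⟨_, hmem⟩
      (max_lt (div_lt_self hM0 hq1) (div_lt_self hM0 hs))
  rw [max_lt_iff, div_lt_iff₀ (by linarith), div_lt_iff₀ (by linarith)] at hl
  have hshift : ∀ n : ℕ, ∀ u v, β - s * β ≤ u → u < v → v ≤ β → AEFull A u v → -(2 * n : ℝ) < v →
      ∃ u' v', β - s * β ≤ u' ∧ v' ≤ β ∧ AEFull A u' v' ∧ 0 < v' ∧ v' - u' = v - u := by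
    intro n
    induction n with
    | zero => intro u v h1 h2 h3 h4 h5; exact ⟨u, v, h1, h3, h4, by simpa using h5, rfl⟩
    | succ n ih =>
      intro u v h1 h2 h3 h4 h5
      push_cast at h5
      rcases lt_or_ge 0 v with h6 | h6
      · exact ⟨u, v, h1, h3, h4, h6, rfl⟩
      · obtain ⟨u', v', e1, e2, e3, e4, e5⟩ := ih (u + 2) (v + 2) (by linarith) (by linarith)
          (by linarith) (h4.map_of_nonpos hA h6) (by linarith)
        exact ⟨u', v', e1, e2, e3, e4, by linarith⟩
  obtain ⟨n, hn⟩ := exists_nat_gt (-v / 2)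
  obtain ⟨u', v', hu', hv', hfull', hpos, hlen⟩ := hshift n u v hu huv hv hfull (by linarith)
  have hflip : ∀ a b, 0 ≤ a → a < b → b ≤ β → AEFull A a b → s * (b - a) ≤ M := by
    intro a b h1 h2 h3 h4
    have := hle _ _ (by nlinarith) (by nlinarith) (by nlinarith) (h4.map_of_nonneg hs hA h1)
    linarith
  have hneg : u' < 0 := by
    by_contra! h0
    have := hflip u' v' h0 (by linarith) hv' hfull'
    rw [hlen] at this
    linarith
  by_cases hu2 : u' ≤ -2
  · exact .inl (hfull'.mono hu2 hpos.le)
  by_cases hv2 : β / s ≤ v'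
  · exact .inr (hfull'.mono hneg.le hv2)
  exfalso
  push Not at hu2 hv2
  rw [lt_div_iff₀ hs0] at hv2
  -- Both pieces now have images in `[0, ∞)`, which can be stretched by `s` once more; if `2s ≤ β`
  -- the left piece can be stretched twice.
  have hleft : AEFull A (u' + 2) 2 := by
    simpa using (hfull'.mono le_rfl hpos.le).map_of_nonpos hA le_rfl
  have hright : AEFull A (β - s * v') β := by
    simpa using (hfull'.mono hneg.le le_rfl).map_of_nonneg hs hA le_rfl
  have h1 := hflip _ _ (by linarith) (by linarith) (by linarith) hleft
  have h2 := hflip _ _ (by linarith) (by nlinarith) (by linarith) hright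
  have h3 : 2 * s ≤ β → s ^ 2 * (-u') ≤ M := by
    intro h
    have := hflip _ _ (by linarith) (by nlinarith) (by nlinarith)
      (hleft.map_of_nonneg hs hA (by linarith))
    nlinarith
  have := hq2 (-u') v' (by linarith) hpos.le (by linarith) (by nlinarith) h3
  have : v' - u' = -u' + v' := by ring
  nlinarith

/-! ### Expansion along orbits and affine pull-back -/

/-- The derivative of the `n`-th iterate of `plMap s β`, computed along the orbit. -/
noncomputable def plSlope (s β : ℝ) : ℕ → ℝ → ℝ
  | 0, _ => 1
  | n + 1, x => (if x ≤ 0 then 1 else -s) * plSlope s β n (plMap s β x)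

theorem plSlope_add (s β : ℝ) (k m : ℕ) (x : ℝ) :
    plSlope s β (k + m) x = plSlope s β k x * plSlope s β m ((plMap s β)^[k] x) := by
  induction k generalizing x with
  | zero => simp [plSlope]
  | succ k ih =>
    rw [Nat.succ_add, plSlope, ih, Function.iterate_succ_apply, plSlope, mul_assoc]

theorem one_le_abs_plSlope {s : ℝ} (hs : 1 < s) (β : ℝ) (n : ℕ) (x : ℝ) :
    1 ≤ |plSlope s β n x| := by
  induction n generalizing x with
  | zero => simp [plSlope]
  | succ n ih =>
    rw [plSlope, abs_mul]
    refine one_le_mul_of_one_le_of_one_le ?_ (ih _)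
    split_ifs
    · simp
    · rw [abs_neg]; exact hs.le.trans (le_abs_self s)

/-- At most `n` shifts by `2` bring the point into `(0, ∞)`, where a factor `s` is collected. -/
theorem le_abs_plSlope {s : ℝ} (hs : 1 < s) (β : ℝ) (n : ℕ) {x : ℝ} (hx : -(2 * n : ℝ) < x) :
    s ≤ |plSlope s β (n + 1) x| := by
  have hpos : ∀ n {x : ℝ}, 0 < x → s ≤ |plSlope s β (n + 1) x| := by
    intro n x h
    rw [plSlope, if_neg h.not_ge, abs_mul, abs_neg, abs_of_pos (by linarith : 0 < s)]
    exact le_mul_of_one_le_right (by linarith) (one_le_abs_plSlope hs β _ _)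
  induction n generalizing x with
  | zero => exact hpos 0 (by simpa using hx)
  | succ n ih =>
    rcases lt_or_ge 0 x with h | h
    · exact hpos _ h
    · rw [plSlope, if_pos h, one_mul, plMap_of_nonpos h]
      push_cast at hx
      exact ih (by linarith)

/-- The iterates of `plMap s β` expand exponentially fast. -/
theorem exists_pow_le_plSlope {s β : ℝ} (hs : 1 < s) (hβ : 2 < β) :
    ∃ q : ℝ, 1 < q ∧ ∀ m, ∀ x ∈ Set.Ioo (β - s * β) β, q ^ m ≤ s * |plSlope s β m x| := by
  obtain ⟨n, hn⟩ := exists_nat_gt ((s * β - β) / 2)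
  have hN : ∀ x ∈ Set.Ioo (β - s * β) β, s ≤ |plSlope s β (n + 1) x| :=
    fun x hx => le_abs_plSlope hs β n (by linarith [hx.1])
  have hs0 : 0 < s := by linarith
  -- Each block of `n + 1` steps expands by at least `s = q ^ (n + 1)`; the prefactor `s` in the
  -- claim absorbs an incomplete block.
  set q : ℝ := s ^ (1 / ((n + 1 : ℕ) : ℝ)) with hq
  have hq1 : 1 < q := Real.one_lt_rpow hs (by positivity)
  have hqN : q ^ (n + 1) = s := by
    rw [hq, ← Real.rpow_natCast, ← Real.rpow_mul hs0.le, one_div_mul_cancel (by positivity),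
      Real.rpow_one]
  refine ⟨q, hq1, fun m => ?_⟩
  induction m using Nat.strong_induction_on with
  | _ m ih =>
    intro x hx
    rcases lt_or_ge m (n + 1) with h | h
    · calc q ^ m ≤ q ^ (n + 1) := pow_le_pow_right₀ hq1.le h.le
        _ = s := hqN
        _ ≤ _ := le_mul_of_one_le_right hs0.le (one_le_abs_plSlope hs β _ _)
    · obtain ⟨k, rfl⟩ := Nat.exists_eq_add_of_le h
      have h1 := ih k (by omega) _ (iterate_plMap_mem_Ioo hs hβ hx (n + 1))
      rw [plSlope_add, abs_mul, pow_add, hqN]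
      have h2 := hN x hx
      have h3 := abs_nonneg (plSlope s β k ((plMap s β)^[n + 1] x))
      calc s * q ^ k ≤ s * (s * |plSlope s β k ((plMap s β)^[n + 1] x)|) := by gcongr
        _ ≤ s * (|plSlope s β (n + 1) x| * |plSlope s β k ((plMap s β)^[n + 1] x)|) := by gcongr

/-- As long as the images of a ball around `x` do not meet the discontinuity, the iterate is affine
on the ball. -/
theorem iterate_plMap_eq_affine {s : ℝ} (hs : 1 < s) (β : ℝ) (n : ℕ) {x y ρ : ℝ}
    (h : ∀ k < n, |plSlope s β k x| * ρ ≤ |(plMap s β)^[k] x|) (hy : |y - x| < ρ) :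
    (plMap s β)^[n] y = (plMap s β)^[n] x + plSlope s β n x * (y - x) := by
  induction n generalizing x y ρ with
  | zero => simp [plSlope]
  | succ n ih =>
    have h0 : ρ ≤ |x| := by simpa [plSlope] using h 0 (by omega)
    set t : ℝ := if x ≤ 0 then 1 else -s with ht
    have ht0 : 0 < |t| := by
      rw [ht]; split_ifs
      · simp
      · rw [abs_neg]; exact abs_pos.2 (by linarith)
    have hstep : plMap s β y - plMap s β x = t * (y - x) := by
      rw [abs_lt] at hy
      rcases le_or_gt x 0 with hx | hx
      · rw [abs_of_nonpos hx] at h0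
        rw [ht, if_pos hx, plMap_of_nonpos hx, plMap_of_nonpos (by linarith)]
        ring
      · rw [abs_of_pos hx] at h0
        rw [ht, if_neg hx.not_ge, plMap_of_pos hx, plMap_of_pos (by linarith)]
        ring
    have := ih (x := plMap s β x) (y := plMap s β y) (ρ := |t| * ρ) (fun k hk => by
      have := h (k + 1) (by omega)
      rw [plSlope, abs_mul, Function.iterate_succ_apply] at this
      linarith) (by rw [hstep, abs_mul]; gcongr)
    rw [Function.iterate_succ_apply, Function.iterate_succ_apply, this, hstep, plSlope]
    ring

/-- The iterate is affine on the small ball, so it carries the proportion of `Aᶜ` there to scale `δ`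
without distortion. -/
theorem volume_Ioo_diff_le {s : ℝ} (hs : 1 < s) (β : ℝ) {A : Set ℝ} (hA : plMap s β ⁻¹' A = A)
    {n : ℕ} {x δ : ℝ} (hδ : 0 < δ)
    (h : ∀ k < n, |plSlope s β k x| * (δ / |plSlope s β n x|) ≤ |(plMap s β)^[k] x|) :
    volume (Set.Ioo ((plMap s β)^[n] x - δ) ((plMap s β)^[n] x + δ) \ A) ≤
      ENNReal.ofReal (2 * δ) *
        (volume (Aᶜ ∩ Metric.closedBall x (δ / |plSlope s β n x|)) /
          volume (Metric.closedBall x (δ / |plSlope s β n x|))) := by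
  set D := plSlope s β n x with hD
  set y := (plMap s β)^[n] x with hy
  have hD1 : 0 < |D| := lt_of_lt_of_le one_pos (one_le_abs_plSlope hs β n x)
  have hD0 : D ≠ 0 := abs_pos.1 hD1
  set S := Set.Ioo (y - δ) (y + δ) \ A with hS
  have hAn : (plMap s β)^[n] ⁻¹' A = A :=
    Function.IsFixedPt.preimage_iterate (f := plMap s β) hA n
  have hsub : (fun z => D * z + (y - D * x)) ⁻¹' S ⊆ Aᶜ ∩ Metric.closedBall x (δ / |D|) := by
    rintro z ⟨⟨h1, h2⟩, h3⟩
    have h4 : |z - x| < δ / |D| := by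
      rw [lt_div_iff₀ hD1, mul_comm, ← abs_mul, abs_lt]
      simp only at h1 h2
      constructor <;> linarith
    refine ⟨fun hz => h3 ?_, by rw [Metric.mem_closedBall, Real.dist_eq]; exact h4.le⟩
    have h5 := iterate_plMap_eq_affine hs β n h h4
    rw [← hAn, Set.mem_preimage, h5] at hz
    convert hz using 1
    ring
  have h1 : ENNReal.ofReal |D⁻¹| * volume S ≤ volume (Aᶜ ∩ Metric.closedBall x (δ / |D|)) := by
    rw [← volume_preimage_mul_add hD0 (y - D * x)]
    exact measure_mono hsub
  have h2 : volume S = ENNReal.ofReal |D| * (ENNReal.ofReal |D⁻¹| * volume S) := by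
    rw [← mul_assoc, ← ENNReal.ofReal_mul hD1.le, ← abs_mul, mul_inv_cancel₀ hD0]
    simp
  have hρ : 0 < δ / |D| := div_pos hδ hD1
  rw [h2, Real.volume_closedBall]
  calc _ ≤ ENNReal.ofReal |D| * volume (Aᶜ ∩ Metric.closedBall x (δ / |D|)) := by gcongr
    _ = ENNReal.ofReal |D| * (ENNReal.ofReal (2 * (δ / |D|)) *
        (volume (Aᶜ ∩ Metric.closedBall x (δ / |D|)) / ENNReal.ofReal (2 * (δ / |D|)))) := by
      rw [ENNReal.mul_div_cancel (by simpa using hρ) ENNReal.ofReal_ne_top]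
    _ = _ := by
      rw [← mul_assoc, ← ENNReal.ofReal_mul hD1.le]
      congr 2
      field_simp

/-! ### From positive measure to a full interval; ergodicity -/

theorem sum_range_pow_sub_le {r : ℝ} (h0 : 0 ≤ r) (h1 : r < 1) (n : ℕ) :
    ∑ k ∈ Finset.range n, r ^ (n - k) ≤ r / (1 - r) := by
  induction n with
  | zero => simpa using div_nonneg h0 (by linarith)
  | succ n ih =>
    have : ∑ k ∈ Finset.range (n + 1), r ^ (n + 1 - k)
        = r * ∑ k ∈ Finset.range n, r ^ (n - k) + r := by
      rw [Finset.sum_range_succ, Finset.mul_sum]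
      congr 1
      · refine Finset.sum_congr rfl fun k hk => ?_
        rw [← pow_succ']
        congr 1
        have := Finset.mem_range.1 hk
        omega
      · simp
    rw [this]
    calc r * ∑ k ∈ Finset.range n, r ^ (n - k) + r ≤ r * (r / (1 - r)) + r := by gcongr
      _ = r / (1 - r) := by field_simp [(by linarith : 1 - r ≠ 0)]; ring

/-- An invariant set of positive measure for an invariant measure with bounded density is full on
some interval. -/
theorem exists_aeFull {s β : ℝ} (hs : 1 < s) (hβ : 2 < β) {ν : Measure ℝ}
    (hν : MeasurePreserving (plMap s β) ν ν) (hac : ν ≪ volume)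
    (hJ : ∀ᵐ x ∂ν, x ∈ Set.Ioo (β - s * β) β) {C : ℝ} (hC : 0 ≤ C)
    (hνC : ∀ r > 0, ν {z | |z| < r} ≤ ENNReal.ofReal (C * r))
    {A : Set ℝ} (hAm : MeasurableSet A) (hA : plMap s β ⁻¹' A = A) (hpos : ν A ≠ 0) :
    ∃ a b, a < b ∧ β - s * β ≤ a ∧ b ≤ β ∧ AEFull A a b := by
  obtain ⟨q, hq1, hq⟩ := exists_pow_le_plSlope hs hβ
  have hs0 : 0 < s := by linarith
  have hq0 : 0 < q := by linarith
  have hr1 : q⁻¹ < 1 := inv_lt_one_of_one_lt₀ hq1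
  set K : ℝ := C * s * (q⁻¹ / (1 - q⁻¹)) with hK
  have hK0 : 0 ≤ K := mul_nonneg (by positivity) (div_nonneg (by positivity) (by linarith))
  obtain ⟨δ, hδ, hδA⟩ : ∃ δ : ℝ, 0 < δ ∧ ENNReal.ofReal (K * δ) < ν A := by
    obtain ⟨t, ht0, ht⟩ := ENNReal.lt_iff_exists_real_btwn.1 (pos_iff_ne_zero.2 hpos)
    have ht1 : 0 < t := by simpa using ht.1
    refine ⟨t / (K + 1), by positivity, lt_of_le_of_lt (ENNReal.ofReal_le_ofReal ?_) ht.2⟩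
    rw [← mul_div_assoc, div_le_iff₀ (by linarith)]
    nlinarith
  -- Bad points at time `n`: the orbit comes so close to `0` at some time `k < n` that the pull-back
  -- of the `δ`-ball around the `n`-th image might meet the discontinuity. The geometric radii keep
  -- the measure below `K * δ`, uniformly in `n`.
  set B : ℕ → Set ℝ := fun n => ⋃ k ∈ Finset.range n,
    (plMap s β)^[k] ⁻¹' {z | |z| < δ * s * q⁻¹ ^ (n - k)} with hB
  have hBν : ∀ n, ν (B n) ≤ ENNReal.ofReal (K * δ) := by
    intro n
    calc ν (B n) ≤ ∑ k ∈ Finset.range n,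
          ν ((plMap s β)^[k] ⁻¹' {z | |z| < δ * s * q⁻¹ ^ (n - k)}) := measure_biUnion_finset_le _ _
      _ ≤ ∑ k ∈ Finset.range n, ENNReal.ofReal (C * (δ * s * q⁻¹ ^ (n - k))) := by
        refine Finset.sum_le_sum fun k _ => ?_
        rw [(hν.iterate k).measure_preimage
          (measurableSet_lt (by fun_prop) measurable_const).nullMeasurableSet]
        exact hνC _ (by positivity)
      _ = ENNReal.ofReal (C * s * δ * ∑ k ∈ Finset.range n, q⁻¹ ^ (n - k)) := by
        rw [← ENNReal.ofReal_sum_of_nonneg fun k _ => by positivity, Finset.mul_sum]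
        congr 1
        exact Finset.sum_congr rfl fun k _ => by ring
      _ ≤ ENNReal.ofReal (K * δ) := by
        refine ENNReal.ofReal_le_ofReal ?_
        have := sum_range_pow_sub_le (inv_nonneg.2 hq0.le) hr1 n
        calc _ ≤ C * s * δ * (q⁻¹ / (1 - q⁻¹)) := by gcongr
          _ = _ := by rw [hK]; ring
  have hliminf : ν (⋃ N : ℕ, ⋂ n ≥ N, B n) ≤ ENNReal.ofReal (K * δ) := by
    rw [Monotone.measure_iUnion]
    · exact iSup_le fun N => (measure_mono (Set.biInter_subset_of_mem (le_refl N))).trans (hBν N)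
    · intro N M hNM x hx
      simp only [Set.mem_iInter] at hx ⊢
      exact fun n hn => hx n (hNM.trans hn)
  have hdens := hac.ae_le
    (Besicovitch.ae_tendsto_measure_inter_div_of_measurableSet (volume : Measure ℝ) hAm.compl)
  -- The points that are eventually always bad have measure less than `ν A`, so some density point
  -- of `A` is good infinitely often.
  obtain ⟨x, hxA, hxJ, hxd, hxB⟩ : ∃ x ∈ A, x ∈ Set.Ioo (β - s * β) β ∧
      Tendsto (fun r => volume (Aᶜ ∩ Metric.closedBall x r) / volume (Metric.closedBall x r))
        (𝓝[>] 0) (𝓝 (Aᶜ.indicator 1 x)) ∧ x ∉ ⋃ N : ℕ, ⋂ n ≥ N, B n := by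
    by_contra! hcon
    refine absurd (measure_mono_ae (?_ : A ≤ᵐ[ν] ⋃ N : ℕ, ⋂ n ≥ N, B n))
      (not_le.2 (hliminf.trans_lt hδA))
    filter_upwards [hJ, hdens] with x h1 h2 h3
    exact hcon x h3 h1 h2
  have hfreq : ∀ N, ∃ n ≥ N, x ∉ B n := by
    simpa using hxB
  obtain ⟨φ, hφ, hφB⟩ := extraction_of_frequently_atTop (frequently_atTop.2 hfreq)
  obtain ⟨y, hyJ, ψ, hψ, hy⟩ := (isCompact_Icc (a := β - s * β) (b := β)).tendsto_subseq
    (x := fun n => (plMap s β)^[φ n] x)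
    fun n => Set.Ioo_subset_Icc_self (iterate_plMap_mem_Ioo hs hβ hxJ _)
  set e : ℕ → ℕ := φ ∘ ψ with he
  have hemono : StrictMono e := hφ.comp hψ
  set ρ : ℕ → ℝ := fun n => δ / |plSlope s β (e n) x| with hρ
  have hρpos : ∀ n, 0 < ρ n := fun n =>
    div_pos hδ (lt_of_lt_of_le one_pos (one_le_abs_plSlope hs β _ x))
  have hslope : ∀ m, ∀ z ∈ Set.Ioo (β - s * β) β, δ / |plSlope s β m z| ≤ δ * s * q⁻¹ ^ m := by
    intro m z hz
    have h1 := hq m z hz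
    have h2 : 0 < |plSlope s β m z| := lt_of_lt_of_le one_pos (one_le_abs_plSlope hs β _ z)
    rw [inv_pow, div_le_iff₀ h2, mul_assoc, mul_assoc]
    refine le_mul_of_one_le_right hδ.le ?_
    rw [← div_eq_inv_mul, ← mul_div_assoc, one_le_div (by positivity)]
    exact h1
  have hρ0 : Tendsto ρ atTop (𝓝[>] 0) := by
    refine tendsto_nhdsWithin_iff.2 ⟨?_, .of_forall hρpos⟩
    have h1 : Tendsto (fun n => δ * s * q⁻¹ ^ (e n)) atTop (𝓝 (δ * s * 0)) :=
      ((tendsto_pow_atTop_nhds_zero_of_lt_one (inv_nonneg.2 hq0.le) hr1).comp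
        hemono.tendsto_atTop).const_mul _
    rw [mul_zero] at h1
    exact squeeze_zero (fun n => (hρpos n).le) (fun n => hslope _ x hxJ) h1
  have hbound : ∀ n, volume (Set.Ioo ((plMap s β)^[e n] x - δ) ((plMap s β)^[e n] x + δ) \ A) ≤
      ENNReal.ofReal (2 * δ) * (volume (Aᶜ ∩ Metric.closedBall x (ρ n)) /
        volume (Metric.closedBall x (ρ n))) := by
    intro n
    refine volume_Ioo_diff_le hs β hA hδ fun k hk => ?_
    have h1 : (plMap s β)^[k] x ∈ Set.Ioo (β - s * β) β := iterate_plMap_mem_Ioo hs hβ hxJ k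
    have h2 : δ * s * q⁻¹ ^ (e n - k) ≤ |(plMap s β)^[k] x| := by
      have := hφB (ψ n)
      simp only [hB, Set.mem_iUnion, Finset.mem_range, Set.mem_preimage, not_exists] at this
      exact not_lt.1 (this k hk)
    refine le_trans ?_ ((hslope _ _ h1).trans h2)
    have h3 : plSlope s β (e n) x
        = plSlope s β k x * plSlope s β (e n - k) ((plMap s β)^[k] x) := by
      rw [← plSlope_add, Nat.add_sub_cancel' hk.le]
    have h4 : 0 < |plSlope s β k x| := lt_of_lt_of_le one_pos (one_le_abs_plSlope hs β _ x)
    rw [h3, abs_mul, ← mul_div_assoc, mul_div_mul_left _ _ h4.ne']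
  have hlim : Tendsto (fun n => ENNReal.ofReal (2 * δ) *
      (volume (Aᶜ ∩ Metric.closedBall x (ρ n)) / volume (Metric.closedBall x (ρ n)))) atTop
      (𝓝 0) := by
    have h1 := hxd.comp hρ0
    rw [Set.indicator_of_notMem (by simpa using hxA)] at h1
    have h2 := ENNReal.Tendsto.const_mul (a := ENNReal.ofReal (2 * δ)) h1
      (.inr ENNReal.ofReal_ne_top)
    rwa [mul_zero] at h2
  -- Along the good times the images converge to `y`, so their `δ`-balls eventually contain this
  -- interval, while the part missing from `A` shrinks to measure zero.
  have hfull : AEFull A (y - δ / 2) (y + δ / 2) := by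
    refine le_antisymm (ge_of_tendsto hlim ?_) zero_le
    filter_upwards [Metric.tendsto_nhds.1 hy (δ / 2) (half_pos hδ)] with n hn
    refine le_trans (measure_mono (Set.sdiff_subset_sdiff_left (Set.Ioo_subset_Ioo ?_ ?_)))
      (hbound n)
    all_goals
      rw [Real.dist_eq, abs_lt] at hn
      simp only [Function.comp_apply, he] at hn ⊢
      linarith [hn.1, hn.2]
  refine ⟨max (y - δ / 2) (β - s * β), min (y + δ / 2) β, ?_, le_max_right _ _, min_le_right _ _,
    hfull.mono (le_max_left _ _) (min_le_left _ _)⟩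
  rw [max_lt_iff, lt_min_iff, lt_min_iff]
  refine ⟨⟨by linarith, by linarith [hyJ.2]⟩, by linarith [hyJ.1], by nlinarith⟩

/-- An invariant measure with bounded density is ergodic. -/
theorem ergodic_plMap {s β : ℝ} (hs : 1 < s) (hβ : 2 < β)
    (hexp : s + 1 < s ^ 2 ∨ 2 * s ≤ β ∧ 2 < s ^ 2) {ν : Measure ℝ}
    (hν : MeasurePreserving (plMap s β) ν ν) (hac : ν ≪ volume)
    (hJ : ∀ᵐ x ∂ν, x ∈ Set.Ioo (β - s * β) β) {C : ℝ} (hC : 0 ≤ C)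
    (hνC : ∀ r > 0, ν {z | |z| < r} ≤ ENNReal.ofReal (C * r)) :
    Ergodic (plMap s β) ν := by
  refine ⟨hν, ⟨fun {A} hAm hA => ?_⟩⟩
  rw [eventuallyConst_set]
  by_contra! hcon
  have hcA : plMap s β ⁻¹' Aᶜ = Aᶜ := by rw [Set.preimage_compl, hA]
  have large : ∀ {A : Set ℝ}, MeasurableSet A → plMap s β ⁻¹' A = A → ν A ≠ 0 →
      AEFull A (-2) 0 ∨ AEFull A 0 (β / s) := by
    intro A hAm hA h
    obtain ⟨a, b, hab, ha, hb, hfull⟩ := exists_aeFull hs hβ hν hac hJ hC hνC hAm hA h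
    exact hfull.exists_large hs hβ hexp hA hab ha hb
  have h1 := large hAm hA fun h => hcon.2 (measure_eq_zero_iff_ae_notMem.1 h)
  have h2 := large hAm.compl hcA fun h => hcon.1 (by
    simpa using measure_eq_zero_iff_ae_notMem.1 h)
  have hpos : 0 < min 2 (β / s) := lt_min two_pos (div_pos (by linarith) (by linarith))
  -- Since `(-2, 0)` shifts onto `(0, 2)`, a set and its complement would both be full on the same
  -- interval.
  have reduce : ∀ {A : Set ℝ}, plMap s β ⁻¹' A = A → AEFull A (-2) 0 ∨ AEFull A 0 (β / s) →
      AEFull A 0 (min 2 (β / s)) := by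
    rintro A hA (h | h)
    · have := h.map_of_nonpos hA le_rfl
      norm_num at this
      exact this.mono le_rfl (min_le_left _ _)
    · exact h.mono le_rfl (min_le_right _ _)
  exact (reduce hA h1).not_compl hpos (reduce hcA h2)

/-! ### Transfer operator and reduction to an invariant density -/

open scoped ENNReal

theorem lintegral_comp_mul_add {c : ℝ} (hc : c ≠ 0) (d : ℝ) {G : ℝ → ℝ≥0∞} (hG : Measurable G) :
    ∫⁻ x, G (c * x + d) = ENNReal.ofReal |c⁻¹| * ∫⁻ x, G x := by
  have hmap : Measure.map (fun x : ℝ => c * x + d) volume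
      = ENNReal.ofReal |c⁻¹| • (volume : Measure ℝ) := by
    ext S hS
    rw [Measure.map_apply (by fun_prop) hS, volume_preimage_mul_add hc, Measure.smul_apply,
      smul_eq_mul]
  rw [← smul_eq_mul, ← lintegral_smul_measure, ← hmap, lintegral_map hG (by fun_prop)]

/-- A density fixed by the transfer operator of `plMap s β` defines an invariant measure. -/
theorem measurePreserving_plMap_withDensity {s β : ℝ} (hs : 0 < s) {h : ℝ → ℝ≥0∞}
    (hm : Measurable h)
    (htr : ∀ᵐ x, h x = (if x ≤ 2 then h (x - 2) else 0) +
      ENNReal.ofReal s⁻¹ * (if x < β then h ((β - x) / s) else 0)) :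
    MeasurePreserving (plMap s β) (volume.withDensity h) (volume.withDensity h) := by
  refine ⟨measurable_plMap s β, ?_⟩
  ext B hB
  have hTB := measurable_plMap s β hB
  rw [Measure.map_apply (measurable_plMap s β) hB, withDensity_apply _ hTB, withDensity_apply _ hB,
    ← lintegral_indicator hTB, ← lintegral_indicator hB]
  -- `G₁` and `G₂` are the contributions of the two inverse branches, before the Jacobian factor.
  set G₁ : ℝ → ℝ≥0∞ := B.indicator fun y => if y ≤ 2 then h (y - 2) else 0 with hG₁
  set G₂ : ℝ → ℝ≥0∞ := B.indicator fun y => if y < β then h ((β - y) / s) else 0 with hG₂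
  have hG₁m : Measurable G₁ := (Measurable.ite measurableSet_Iic (by fun_prop)
    measurable_const).indicator hB
  have hG₂m : Measurable G₂ := (Measurable.ite measurableSet_Iio (by fun_prop)
    measurable_const).indicator hB
  classical
  have hsplit : ∀ x, (plMap s β ⁻¹' B).indicator h x = G₁ (1 * x + 2) + G₂ (-s * x + β) := by
    intro x
    have e1 : (1 * x + 2 ≤ 2) ↔ x ≤ 0 := by constructor <;> intro <;> linarith
    have e2 : (-s * x + β < β) ↔ ¬ x ≤ 0 := by
      constructor <;> intro h <;> [skip; push Not at h] <;> [push Not; skip] <;> nlinarith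
    have e3 : (β - (-s * x + β)) / s = x := by field_simp; ring
    have e4 : (plMap s β ⁻¹' B).indicator h x = if plMap s β x ∈ B then h x else 0 := by
      by_cases hx : plMap s β x ∈ B
      · rw [Set.indicator_of_mem (show x ∈ plMap s β ⁻¹' B from hx), if_pos hx]
      · rw [Set.indicator_of_notMem (show x ∉ plMap s β ⁻¹' B from hx), if_neg hx]
    rw [e4]
    simp only [hG₁, hG₂, Set.indicator, e1, e2, e3]
    by_cases hx : x ≤ 0
    · simp [plMap, hx]
    · simp [plMap, hx]
  simp_rw [hsplit]
  rw [lintegral_add_left (f := fun x => G₁ (1 * x + 2)) (hG₁m.comp (by fun_prop)), lintegral_comp_mul_add one_ne_zero _ hG₁m,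
    lintegral_comp_mul_add (by linarith) _ hG₂m]
  have hs' : |(-s)⁻¹| = s⁻¹ := by rw [abs_inv, abs_neg, abs_of_pos hs]
  simp only [inv_one, abs_one, ENNReal.ofReal_one, one_mul, hs']
  rw [← lintegral_const_mul _ hG₂m, ← lintegral_add_left hG₁m]
  refine lintegral_congr_ae ?_
  filter_upwards [htr] with x hx
  by_cases hxB : x ∈ B
  · simp only [hG₁, hG₂, Set.indicator_of_mem hxB]
    exact hx.symm
  · simp [hG₁, hG₂, Set.indicator_of_notMem hxB]

theorem deriv_plMap_of_neg {s β x : ℝ} (hx : x < 0) : deriv (plMap s β) x = 1 := by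
  have : plMap s β =ᶠ[𝓝 x] fun y => y + 2 := by
    filter_upwards [Iio_mem_nhds hx] with y hy using plMap_of_nonpos (le_of_lt hy)
  rw [this.deriv_eq]
  simp

theorem deriv_plMap_of_pos {s β x : ℝ} (hx : 0 < x) : deriv (plMap s β) x = -s := by
  have : plMap s β =ᶠ[𝓝 x] fun y => -s * y + β := by
    filter_upwards [Ioi_mem_nhds hx] with y hy using plMap_of_pos hy
  rw [this.deriv_eq]
  simp

theorem log_abs_deriv_plMap {s β x : ℝ} (hx : x ≠ 0) :
    Real.log |deriv (plMap s β) x| = (Set.Ioi 0).indicator (fun _ => Real.log s) x := by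
  rcases lt_or_gt_of_ne hx with h | h
  · simp [deriv_plMap_of_neg h, h.le]
  · simp [deriv_plMap_of_pos h, h]

/-- Every invariant probability measure of `plMap s β` lives on the trapping interval. -/
theorem ae_mem_Ioo_of_measurePreserving {s β : ℝ} (hs : 1 < s) (hβ : 2 < β) {μ : Measure ℝ}
    [IsProbabilityMeasure μ] (hμ : MeasurePreserving (plMap s β) μ μ) :
    ∀ᵐ x ∂μ, x ∈ Set.Ioo (β - s * β) β := by
  set J := Set.Ioo (β - s * β) β with hJ
  have hmono : Monotone fun n => (plMap s β)^[n] ⁻¹' J := by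
    refine monotone_nat_of_le_succ fun n x hx => ?_
    rw [Set.mem_preimage, Function.iterate_succ_apply']
    exact plMap_mem_Ioo hs hβ hx
  have huniv : ⋃ n, (plMap s β)^[n] ⁻¹' J = Set.univ := by
    ext x
    simpa only [Set.mem_iUnion, Set.mem_preimage, Set.mem_univ, iff_true] using
      exists_iterate_plMap_mem_Ioo hs hβ x
  -- The preimages of `J` exhaust the line, yet by invariance all have measure `μ J`.
  have h1 := hmono.measure_iUnion (μ := μ)
  have h2 : ∀ n, μ ((plMap s β)^[n] ⁻¹' J) = μ J := fun n =>
    (hμ.iterate n).measure_preimage measurableSet_Ioo.nullMeasurableSet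
  simp only [huniv, measure_univ, h2, ciSup_const] at h1
  exact (prob_compl_eq_zero_iff measurableSet_Ioo).2 h1.symm

theorem lyapunovExponentEq_of_density {s β l : ℝ} (hs : 1 < s) (hβ : 2 < β)
    (hexp : s + 1 < s ^ 2 ∨ 2 * s ≤ β ∧ 2 < s ^ 2) {h : ℝ → ℝ} (hm : Measurable h)
    (hi : Integrable h) (hnn : ∀ x, 0 ≤ h x) {C : ℝ} (hC : ∀ x, h x ≤ C)
    (hpos : ∀ x ∈ Set.Ioo (β - s * β) β, 0 < h x)
    (htr : ∀ᵐ x, h x = (if x ≤ 2 then h (x - 2) else 0) +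
      s⁻¹ * (if x < β then h ((β - x) / s) else 0))
    (hone : ∫ x, h x = 1) (hl : ∫ x in Set.Ioi 0, h x = l) :
    LyapunovExponentEq (plMap s β) (l * Real.log s) := by
  set ν : Measure ℝ := volume.withDensity fun x => ENNReal.ofReal (h x) with hν
  have hs0 : 0 < s := by linarith
  have hνp : IsProbabilityMeasure ν := by
    constructor
    rw [hν, withDensity_apply _ .univ, Measure.restrict_univ,
      ← ofReal_integral_eq_lintegral_ofReal hi (.of_forall hnn), hone, ENNReal.ofReal_one]
  have hinv : MeasurePreserving (plMap s β) ν ν := by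
    refine measurePreserving_plMap_withDensity hs0 hm.ennreal_ofReal ?_
    filter_upwards [htr] with x hx
    rw [hx, ENNReal.ofReal_add (by split_ifs <;> simp [hnn])
      (mul_nonneg (by positivity) (by split_ifs <;> simp [hnn])), ENNReal.ofReal_mul (by positivity)]
    split_ifs <;> simp
  have hac : ν ≪ volume := withDensity_absolutelyContinuous _ _
  have hJ := ae_mem_Ioo_of_measurePreserving hs hβ hinv
  have hC0 : 0 ≤ C := (hnn 0).trans (hC 0)
  have hball : ∀ r > 0, ν {z | |z| < r} ≤ ENNReal.ofReal (C * 2 * r) := by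
    intro r hr
    have : {z : ℝ | |z| < r} = Set.Ioo (-r) r := by ext; simp [abs_lt]
    rw [this, hν, withDensity_apply _ measurableSet_Ioo]
    calc _ ≤ ∫⁻ _ in Set.Ioo (-r) r, ENNReal.ofReal C :=
          lintegral_mono fun x => ENNReal.ofReal_le_ofReal (hC x)
      _ = _ := by
        rw [setLIntegral_const, Real.volume_Ioo, ← ENNReal.ofReal_mul hC0]
        congr 1
        ring
  have herg := ergodic_plMap hs hβ hexp hinv hac hJ (by positivity) hball
  refine ⟨⟨ν, hνp, hinv, hac⟩, fun μ hμ => ?_⟩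
  obtain ⟨hμp, hμinv, hμac⟩ := hμ
  have hμν : μ = ν := by
    -- Positivity of `h` on the trapping interval, which carries `μ`, gives `μ ≪ ν`; ergodicity of
    -- `ν` then forces equality.
    refine herg.eq_of_absolutelyContinuous hμinv fun S hS => ?_
    have hμJ := ae_mem_Ioo_of_measurePreserving hs hβ hμinv
    rw [hν, withDensity_apply_eq_zero hm.ennreal_ofReal] at hS
    rw [measure_eq_zero_iff_ae_notMem]
    filter_upwards [hμJ, measure_eq_zero_iff_ae_notMem.1 (hμac hS)] with x h1 h2 h3
    exact h2 ⟨by simpa using hpos x h1, h3⟩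
  subst hμν
  have hne : ∀ᵐ x ∂ν, x ≠ 0 := hac.ae_le (by simp [ae_iff] : ∀ᵐ x : ℝ, x ≠ 0)
  have hderiv : ∀ x : ℝ, x ≠ 0 → deriv (plMap s β) x ≠ 0 := by
    intro x hx
    rcases lt_or_gt_of_ne hx with h | h
    · simp [deriv_plMap_of_neg h]
    · rw [deriv_plMap_of_pos h]; linarith
  set g : ℝ → ℝ := (Set.Ioi 0).indicator fun _ => Real.log s with hg
  have hgm : Measurable g := measurable_const.indicator measurableSet_Ioi
  have hgi : Integrable g ν := (integrable_const _).indicator measurableSet_Ioi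
  have hlog : (fun x => Real.log |deriv (plMap s β) x|) =ᵐ[ν] g := by
    filter_upwards [hne] with x hx using log_abs_deriv_plMap hx
  have hgint : ∫ x, g x ∂ν = l * Real.log s := by
    rw [hg, integral_indicator measurableSet_Ioi, setIntegral_const, smul_eq_mul, measureReal_def,
      hν, withDensity_apply _ measurableSet_Ioi,
      ← ofReal_integral_eq_lintegral_ofReal hi.integrableOn (.of_forall hnn), hl,
      ENNReal.toReal_ofReal (hl ▸ integral_nonneg hnn)]
  refine ⟨⟨hne.mono hderiv, hgi.congr hlog.symm, (integral_congr_ae hlog).trans hgint⟩, ?_⟩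
  -- Almost no orbit hits `0`, the only point where the derivative is not given by a branch.
  have horb : ∀ᵐ x ∂ν, ∀ k, (plMap s β)^[k] x ≠ 0 :=
    ae_all_iff.2 fun k => (hinv.iterate k).quasiMeasurePreserving.ae hne
  filter_upwards [horb, herg.ae_tendsto_birkhoffSum hgm hgi] with x h1 h2
  refine ⟨fun k => hderiv _ (h1 k), ?_⟩
  rw [hgint] at h2
  refine h2.congr fun n => ?_
  rw [birkhoffSum]
  congr 1
  exact Finset.sum_congr rfl fun k _ => (log_abs_deriv_plMap (h1 k)).symm

/-! ### Step-function densities -/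

/-- The indicator function of `(p, ∞)`. -/
noncomputable def stepAt (p x : ℝ) : ℝ := if p < x then 1 else 0

theorem measurable_stepAt (p : ℝ) : Measurable (stepAt p) :=
  Measurable.ite measurableSet_Ioi measurable_const measurable_const

theorem abs_stepAt_le_one (p x : ℝ) : |stepAt p x| ≤ 1 := by
  unfold stepAt; split_ifs <;> simp

theorem stepAt_sub_stepAt {p q : ℝ} (h : p ≤ q) (x : ℝ) :
    stepAt p x - stepAt q x = (Set.Ioc p q).indicator 1 x := by
  simp only [stepAt, Set.indicator, Set.mem_Ioc, Pi.one_apply]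
  split_ifs <;> grind

/-- The image of `stepAt p` under the transfer operator of `plMap s β`, up to an additive
constant. -/
noncomputable def transferStep (s β p x : ℝ) : ℝ :=
  if p ≤ 0 then stepAt (p + 2) x - stepAt 2 x - s⁻¹ * stepAt β x
  else -(s⁻¹ * stepAt (β - s * p) x)

theorem transfer_stepAt {s β p x : ℝ} (hs : 0 < s) (hx : x ≠ β) (hx' : x ≠ β - s * p) :
    (if x ≤ 2 then stepAt p (x - 2) else 0) + s⁻¹ * (if x < β then stepAt p ((β - x) / s) else 0)
      = s⁻¹ + transferStep s β p x := by
  have e1 : p < x - 2 ↔ p + 2 < x := by constructor <;> intro <;> linarith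
  have e2 : p < (β - x) / s ↔ x < β - s * p := by
    rw [lt_div_iff₀ hs]; constructor <;> intro <;> linarith
  simp only [transferStep, stepAt, e1, e2]
  rcases le_or_gt p 0 with hp | hp
  · have h1 : s * p ≤ 0 := mul_nonpos_of_nonneg_of_nonpos hs.le hp
    rw [if_pos hp]
    rcases lt_or_gt_of_ne hx with h | h <;> split_ifs <;>
      first | (exfalso; linarith) | ring
  · have h1 : 0 < s * p := mul_pos hs hp
    rw [if_neg hp.not_ge]
    rcases lt_or_gt_of_ne hx' with h | h
    · rw [if_pos (show x < β by linarith), if_pos h, if_neg h.not_gt]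
      split_ifs <;> first | (exfalso; linarith) | ring
    · rw [if_neg h.not_gt, if_pos h]
      split_ifs <;> first | (exfalso; linarith) | ring

/-- Reduces the problem to finite algebra. The condition `∑ c = 0` kills the constants `s⁻¹` of
`transfer_stepAt` and makes the density vanish outside the trapping interval; `hmass` and `hmass'`
encode its integrals over `ℝ` and `(0, ∞)`, before division by `Z`. -/
theorem lyapunovExponentEq_of_steps {s β l Z : ℝ} (hs : 1 < s) (hβ : 2 < β)
    (hexp : s + 1 < s ^ 2 ∨ 2 * s ≤ β ∧ 2 < s ^ 2) {n : ℕ} (c p : Fin n → ℝ)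
    (hsum : ∑ i, c i = 0) (hp : ∀ i, p i ∈ Set.Icc (β - s * β) β)
    (htr : ∀ x, ∑ i, c i * transferStep s β (p i) x = ∑ i, c i * stepAt (p i) x)
    (hpos : ∀ x ∈ Set.Ioc (β - s * β) β, 0 < ∑ i, c i * stepAt (p i) x)
    (hZ : 0 < Z) (hmass : ∑ i, c i * p i = -Z) (hmass' : ∑ i, c i * max (p i) 0 = -(l * Z)) :
    LyapunovExponentEq (plMap s β) (l * Real.log s) := by
  set h : ℝ → ℝ := fun x => Z⁻¹ * ∑ i, c i * stepAt (p i) x with hh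
  have hZ' : 0 < Z⁻¹ := inv_pos.2 hZ
  have hs0 : 0 < s := by linarith
  have hind : h = fun x => Z⁻¹ * ∑ i, c i * (Set.Ioc (p i) β).indicator 1 x := by
    funext x
    simp_rw [hh, ← stepAt_sub_stepAt (hp _).2, mul_sub, Finset.sum_sub_distrib, ← Finset.sum_mul,
      hsum]
    simp
  have hone_int : ∀ a : ℝ, Integrable ((Set.Ioc a β).indicator (1 : ℝ → ℝ)) := fun a =>
    (integrable_indicator_iff measurableSet_Ioc).2
      (integrableOn_const (by simp) (by simp))
  have hint : Integrable h := by
    rw [hind]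
    exact (integrable_finsetSum _ fun i _ => (hone_int _).const_mul _).const_mul _
  have hout : ∀ x ∉ Set.Ioc (β - s * β) β, h x = 0 := by
    intro x hx
    rw [hind]
    simp only
    rw [Finset.sum_eq_zero fun i _ => ?_, mul_zero]
    rw [Set.indicator_of_notMem fun hx' => hx ⟨lt_of_le_of_lt (hp i).1 hx'.1, hx'.2⟩, mul_zero]
  refine lyapunovExponentEq_of_density hs hβ hexp (h := h) (C := Z⁻¹ * ∑ i, |c i|) ?_ hint ?_ ?_ ?_
    ?_ ?_ ?_
  · exact (Finset.measurable_sum _ fun i _ => (measurable_stepAt _).const_mul _).const_mul _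
  · intro x
    by_cases hx : x ∈ Set.Ioc (β - s * β) β
    · exact (mul_pos hZ' (hpos x hx)).le
    · exact (hout x hx).ge
  · intro x
    refine mul_le_mul_of_nonneg_left (Finset.sum_le_sum fun i _ => ?_) hZ'.le
    calc c i * stepAt (p i) x ≤ |c i * stepAt (p i) x| := le_abs_self _
      _ = |c i| * |stepAt (p i) x| := abs_mul _ _
      _ ≤ |c i| := mul_le_of_le_one_right (abs_nonneg _) (abs_stepAt_le_one _ _)
  · exact fun x hx => mul_pos hZ' (hpos x (Set.Ioo_subset_Ioc_self hx))
  · have hae : ∀ᵐ x : ℝ, ∀ i, x ≠ β - s * p i := ae_all_iff.2 fun i => by simp [ae_iff]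
    filter_upwards [hae, (by simp [ae_iff] : ∀ᵐ x : ℝ, x ≠ β)] with x h1 h2
    have h3 : ∑ i, c i * stepAt (p i) x = ∑ i, c i * ((if x ≤ 2 then stepAt (p i) (x - 2) else 0) +
        s⁻¹ * (if x < β then stepAt (p i) ((β - x) / s) else 0)) := by
      simp_rw [transfer_stepAt hs0 h2 (h1 _), mul_add, Finset.sum_add_distrib, ← Finset.sum_mul,
        hsum, htr]
      simp
    simp only [hh]
    rw [h3]
    split_ifs <;> simp only [mul_add, Finset.sum_add_distrib, mul_zero, add_zero, zero_add,
      Finset.sum_const_zero, Finset.mul_sum]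
    · congr 1
      exact Finset.sum_congr rfl fun i _ => by ring
    · exact Finset.sum_congr rfl fun i _ => by ring
  · have h1 : ∀ i, ∫ x, (Set.Ioc (p i) β).indicator (1 : ℝ → ℝ) x = β - p i := by
      intro i
      rw [integral_indicator measurableSet_Ioc]
      simp [Real.volume_real_Ioc_of_le (hp i).2]
    rw [hind, integral_const_mul, integral_finsetSum _ fun i _ => (hone_int _).const_mul _]
    simp_rw [integral_const_mul, h1, mul_sub, Finset.sum_sub_distrib, ← Finset.sum_mul, hsum, hmass]
    field_simp
    ring
  · have h1 : ∀ i, ∫ x in Set.Ioi 0, (Set.Ioc (p i) β).indicator (1 : ℝ → ℝ) x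
        = β - max (p i) 0 := by
      intro i
      rw [setIntegral_indicator measurableSet_Ioc]
      have : Set.Ioi 0 ∩ Set.Ioc (p i) β = Set.Ioc (max (p i) 0) β := by
        ext x; simp only [Set.mem_inter_iff, Set.mem_Ioi, Set.mem_Ioc, max_lt_iff]; tauto
      rw [this]
      simp [Real.volume_real_Ioc_of_le (max_le (hp i).2 (by linarith : (0 : ℝ) ≤ β))]
    rw [hind, integral_const_mul,
      integral_finsetSum _ fun i _ => ((hone_int _).const_mul _).integrableOn]
    simp_rw [integral_const_mul, h1, mul_sub, Finset.sum_sub_distrib, ← Finset.sum_mul, hsum,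
      hmass']
    field_simp
    ring

theorem stepAt_of_lt {p x : ℝ} (h : p < x) : stepAt p x = 1 := if_pos h

theorem stepAt_of_le {p x : ℝ} (h : x ≤ p) : stepAt p x = 0 := if_neg h.not_gt

theorem stepAt_nonneg (p x : ℝ) : 0 ≤ stepAt p x := by
  unfold stepAt; split_ifs <;> norm_num

theorem stepAt_antitone {p q : ℝ} (h : p ≤ q) (x : ℝ) : stepAt q x ≤ stepAt p x := by
  rw [← sub_nonneg, stepAt_sub_stepAt h]
  exact Set.indicator_nonneg (fun _ _ => zero_le_one) x

/-! ### Explicit densities -/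

/-- The orbits `2, β - 4, β - 2` and `β, -β, 2 - β` both continue to `4 - β`. Weights start at `-1`
for `2` and `-1/s` for `β`; passing a point of `(0, ∞)` multiplies them by `-1/s`, other points
leave them unchanged. At the meeting point they cancel. -/
theorem lyapunovExponentEq_two_of_le {β : ℝ} (h1 : 2 < β) (h2 : β ≤ 4) :
    LyapunovExponentEq (plMap 2 β) (2 / 3 * Real.log 2) := by
  refine lyapunovExponentEq_of_steps (Z := 9 / 2) one_lt_two h1 (.inl (by norm_num))
    ![-1, 1 / 2, 1 / 2, -1 / 2, 1 / 4, 1 / 4] ![2, β - 4, β - 2, β, -β, 2 - β]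
    ?_ ?_ ?_ ?_ (by norm_num) ?_ ?_
  · simp [Fin.sum_univ_succ]; norm_num
  · intro i
    fin_cases i <;> constructor <;> simp <;> linarith
  · intro x
    have e1 : β - 2 * 2 = β - 4 := by ring
    have e2 : β - 4 + 2 = β - 2 := by ring
    have e3 : β - 2 * (β - 2) = 4 - β := by ring
    have e4 : β - 2 * β = -β := by ring
    have e5 : -β + 2 = 2 - β := by ring
    have e6 : 2 - β + 2 = 4 - β := by ring
    simp only [Fin.sum_univ_succ, Fin.sum_univ_zero, Matrix.cons_val_zero, Matrix.cons_val_succ]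
    simp only [transferStep]
    rw [if_neg (by linarith), if_pos (by linarith), if_neg (by linarith), if_neg (by linarith),
      if_pos (by linarith), if_pos (by linarith), e1, e2, e3, e4, e5, e6]
    ring
  · rintro x ⟨hx1, hx2⟩
    simp only [Fin.sum_univ_succ, Fin.sum_univ_zero, Matrix.cons_val_zero, Matrix.cons_val_succ]
    rw [stepAt_of_le hx2, stepAt_of_lt (by linarith : -β < x)]
    -- The weight `-1` at `2` is offset by two weights `1/2` further left; the step at `-β` leaves
    -- at least `1/4`.
    linarith [stepAt_nonneg (2 - β) x, stepAt_antitone (by linarith : β - 4 ≤ 2) x,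
      stepAt_antitone (by linarith : β - 2 ≤ 2) x]
  · simp only [Fin.sum_univ_succ, Fin.sum_univ_zero, Matrix.cons_val_zero, Matrix.cons_val_succ]
    ring
  · simp only [Fin.sum_univ_succ, Fin.sum_univ_zero, Matrix.cons_val_zero, Matrix.cons_val_succ]
    rw [max_eq_left (by linarith), max_eq_right (by linarith), max_eq_left (by linarith),
      max_eq_left (by linarith), max_eq_right (by linarith), max_eq_right (by linarith)]
    ring

/-- Now `β - 4 > 0` changes the itineraries: the two orbits meet only at `3β - 12`, after five steps
each. -/
theorem lyapunovExponentEq_two_of_gt {β : ℝ} (h1 : 4 < β) (h2 : β < 9 / 2) :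
    LyapunovExponentEq (plMap 2 β) (2 / 3 * Real.log 2) := by
  refine lyapunovExponentEq_of_steps (Z := 27 / 4) one_lt_two (by linarith) (.inl (by norm_num))
    ![-1, 1 / 2, -1 / 4, 1 / 8, 1 / 8, -1 / 2, 1 / 4, 1 / 4, 1 / 4, 1 / 4]
    ![2, β - 4, 8 - β, 3 * β - 16, 3 * β - 14, β, -β, 2 - β, 4 - β, 6 - β]
    ?_ ?_ ?_ ?_ (by norm_num) ?_ ?_
  · simp [Fin.sum_univ_succ]; norm_num
  · intro i
    fin_cases i <;> constructor <;> simp <;> linarith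
  · intro x
    have e1 : β - 2 * 2 = β - 4 := by ring
    have e2 : β - 2 * (β - 4) = 8 - β := by ring
    have e3 : β - 2 * (8 - β) = 3 * β - 16 := by ring
    have e4 : 3 * β - 16 + 2 = 3 * β - 14 := by ring
    have e5 : 3 * β - 14 + 2 = 3 * β - 12 := by ring
    have e6 : β - 2 * β = -β := by ring
    have e7 : -β + 2 = 2 - β := by ring
    have e8 : 2 - β + 2 = 4 - β := by ring
    have e9 : 4 - β + 2 = 6 - β := by ring
    have e10 : β - 2 * (6 - β) = 3 * β - 12 := by ring
    simp only [Fin.sum_univ_succ, Fin.sum_univ_zero, Matrix.cons_val_zero, Matrix.cons_val_succ]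
    simp only [transferStep]
    rw [if_neg (by linarith), if_neg (by linarith), if_neg (by linarith), if_pos (by linarith),
      if_pos (by linarith), if_neg (by linarith), if_pos (by linarith), if_pos (by linarith),
      if_pos (by linarith), if_neg (by linarith), e1, e2, e3, e4, e5, e6, e7, e8, e9, e10]
    ring
  · rintro x ⟨hx1, hx2⟩
    simp only [Fin.sum_univ_succ, Fin.sum_univ_zero, Matrix.cons_val_zero, Matrix.cons_val_succ]
    rw [stepAt_of_le hx2, stepAt_of_lt (by linarith : -β < x)]
    linarith [stepAt_nonneg (4 - β) x, stepAt_antitone (by linarith : β - 4 ≤ 2) x,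
      stepAt_antitone (by linarith : 3 * β - 16 ≤ 2) x,
      stepAt_antitone (by linarith : 3 * β - 14 ≤ 2) x,
      stepAt_antitone (by linarith : 6 - β ≤ 2) x,
      stepAt_antitone (by linarith : 2 - β ≤ 8 - β) x]
  · simp only [Fin.sum_univ_succ, Fin.sum_univ_zero, Matrix.cons_val_zero, Matrix.cons_val_succ]
    ring
  · simp only [Fin.sum_univ_succ, Fin.sum_univ_zero, Matrix.cons_val_zero, Matrix.cons_val_succ]
    rw [max_eq_left (by linarith), max_eq_left (by linarith), max_eq_left (by linarith),
      max_eq_right (by linarith), max_eq_right (by linarith), max_eq_left (by linarith),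
      max_eq_right (by linarith), max_eq_right (by linarith), max_eq_right (by linarith),
      max_eq_left (by linarith)]
    ring

/-- By `g² = g + 1` the orbits of `2` and `β` meet at `2β - 4g` after four steps each. The weights
are `±` powers of `g⁻¹`, linearized by `g⁻¹ = g - 1`, `g⁻² = 2 - g`, `g⁻³ = 2g - 3`. -/
theorem lyapunovExponentEq_goldenRatio {β : ℝ} (h1 : 2 * Real.goldenRatio < β) (h2 : β < 4) :
    LyapunovExponentEq (plMap Real.goldenRatio β)
      ((3 - Real.goldenRatio) / (5 - 2 * Real.goldenRatio) * Real.log Real.goldenRatio) := by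
  have hg : Real.goldenRatio ^ 2 = Real.goldenRatio + 1 := Real.goldenRatio_sq
  have hgpos : 0 < Real.goldenRatio := Real.goldenRatio_pos
  generalize Real.goldenRatio = g at h1 h2 hg hgpos ⊢
  have hg1 : 8 / 5 < g := by nlinarith
  have hg2 : g < 13 / 8 := by nlinarith
  have hinv : g⁻¹ = g - 1 := by
    rw [inv_eq_iff_eq_inv, eq_comm, inv_eq_of_mul_eq_one_left]
    linear_combination hg
  have hL2 : 0 < β - g * β + 2 * g + 2 := by nlinarith
  have hR1 : β - g * β ≤ 0 := by nlinarith
  have hR2 : β - g * β + 2 ≤ 0 := by nlinarith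
  have hR3 : 0 < β - g * β + 4 := by nlinarith
  have hL3 : 2 * β - 4 * g - 2 ≤ 0 := by linarith
  have hL2' : 2 * g + 2 ≤ g * β := by nlinarith
  have hL3' : β - g * β ≤ 2 * β - 4 * g - 2 := by nlinarith
  refine lyapunovExponentEq_of_steps (Z := 6 * g - 4) (by linarith) (by linarith)
    (.inr ⟨h1.le, by linarith⟩)
    ![-1, g - 1, -(2 - g), 2 * g - 3, -(g - 1), 2 - g, 2 - g, 2 - g]
    ![2, β - 2 * g, β - g * β + 2 * g + 2, 2 * β - 4 * g - 2, β, β - g * β, β - g * β + 2,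
      β - g * β + 4]
    ?_ ?_ ?_ ?_ (by linarith) ?_ ?_
  · simp only [Fin.sum_univ_succ, Fin.sum_univ_zero, Matrix.cons_val_zero, Matrix.cons_val_succ]
    ring
  · intro i
    fin_cases i <;> constructor <;> simp <;> linarith
  · intro x
    have e1 : β - g * 2 = β - 2 * g := by ring
    have e2 : β - g * (β - 2 * g) = β - g * β + 2 * g + 2 := by linear_combination 2 * hg
    have e3 : β - g * (β - g * β + 2 * g + 2) = 2 * β - 4 * g - 2 := by
      linear_combination (β - 2) * hg
    have e4 : 2 * β - 4 * g - 2 + 2 = 2 * β - 4 * g := by ring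
    have e5 : β - g * β + 2 + 2 = β - g * β + 4 := by ring
    have e6 : β - g * (β - g * β + 4) = 2 * β - 4 * g := by linear_combination β * hg
    simp only [Fin.sum_univ_succ, Fin.sum_univ_zero, Matrix.cons_val_zero, Matrix.cons_val_succ]
    simp only [transferStep]
    rw [if_neg (by linarith), if_neg (by linarith), if_neg (by linarith), if_pos (by linarith),
      if_neg (by linarith), if_pos (by linarith), if_pos (by linarith), if_neg (by linarith),
      e1, e2, e3, e4, e5, e6, hinv]
    generalize stepAt 2 x = t1
    generalize stepAt β x = t2
    generalize stepAt (β - 2 * g) x = t3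
    generalize stepAt (β - g * β + 2 * g + 2) x = t4
    generalize stepAt (2 * β - 4 * g - 2) x = t5
    generalize stepAt (2 * β - 4 * g) x = t6
    generalize stepAt (β - g * β) x = t7
    linear_combination (-t4 - t5 + t6 + t7) * hg
  · rintro x ⟨hx1, hx2⟩
    simp only [Fin.sum_univ_succ, Fin.sum_univ_zero, Matrix.cons_val_zero, Matrix.cons_val_succ]
    rw [stepAt_of_le hx2, stepAt_of_lt hx1]
    have i1 := mul_le_mul_of_nonneg_left (stepAt_antitone (by linarith : β - 2 * g ≤ 2) x)
      (by linarith : 0 ≤ g - 1)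
    have i2 := mul_le_mul_of_nonneg_left (stepAt_antitone (by linarith : β - g * β + 4 ≤ 2) x)
      (by linarith : 0 ≤ 2 - g)
    have i3 := mul_le_mul_of_nonneg_left
      (stepAt_antitone (by linarith : β - g * β + 2 ≤ β - g * β + 2 * g + 2) x)
      (by linarith : 0 ≤ 2 - g)
    have i4 := mul_nonneg (by linarith : 0 ≤ 2 * g - 3) (stepAt_nonneg (2 * β - 4 * g - 2) x)
    linarith
  · simp only [Fin.sum_univ_succ, Fin.sum_univ_zero, Matrix.cons_val_zero, Matrix.cons_val_succ]
    linear_combination (2 * β - 8) * hg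
  · simp only [Fin.sum_univ_succ, Fin.sum_univ_zero, Matrix.cons_val_zero, Matrix.cons_val_succ]
    rw [max_eq_left (by linarith), max_eq_left (by linarith), max_eq_left (by linarith),
      max_eq_right (by linarith), max_eq_left (by linarith), max_eq_right (by linarith),
      max_eq_right (by linarith), max_eq_left (by linarith)]
    have e : (3 - g) / (5 - 2 * g) * (6 * g - 4) = 4 * g - 2 := by
      rw [div_mul_eq_mul_div, div_eq_iff (by linarith)]
      linear_combination 2 * hg
    rw [e]
    ring

theorem lemma1 :
    (∀ β : ℝ, 2 < β → β < 9 / 2 →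
      LyapunovExponentEq (plMap 2 β) (2 / 3 * Real.log 2)) ∧
    (∀ β : ℝ, 2 * Real.goldenRatio < β → β < 4 →
      LyapunovExponentEq (plMap Real.goldenRatio β)
        ((3 - Real.goldenRatio) / (5 - 2 * Real.goldenRatio) * Real.log Real.goldenRatio)) := by
  refine ⟨fun β h1 h2 => ?_, fun β h1 h2 => lyapunovExponentEq_goldenRatio h1 h2⟩
  rcases le_or_gt β 4 with h | h
  · exact lyapunovExponentEq_two_of_le h1 h
  · exact lyapunovExponentEq_two_of_gt h h2
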